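/- Consider digital good auctions with $n$ bidders: each bidder $i$ has a private value $v_i\ge 0$ for one unit of the good, and any set of bidders may be served. A deterministic auction maps every bid vector $b\in\mathbb{R}_{\ge 0}^n$ to a set of winners and to payments $p_i(b)\ge 0$, where a winner pays at most her bid and a loser pays $0$. It is truthful if, for every bidder and all bids of the others, bidding her own value maximizes her utility (her value if she wins, minus her payment). A randomized auction is a probability distribution over deterministic auctions; it is truthful if it is a distribution over truthful deterministic auctions. A (learning-augmented) mechanism $\mathcal M=\{\mathcal M^{\hat v}\}$ consists of one randomized auction $\mathcal M^{\hat v}$ for every prediction vector $\hat v\in\mathbb{R}_{\ge 0}^n$; it is truthful if every $\mathcal M^{\hat v}$ is. Write $\mathcal M^{\hat v}(v)$ for the expected revenue (total payment) of $\mathcal M^{\hat v}$ when the bids are $v$. The mechanism is $\mu$-consistent against a benchmark $f_1$ if $\mathcal M^{\hat v}(\hat v)\ge f_1(\hat v)/\mu$ for all $\hat v$, and $\alpha$-robust against $f_2$ if $\mathcal M^{\hat v}(v)\ge f_2(v)/\alpha$ for all $\hat v, v$. Let $v_{(1)}\ge v_{(2)}\ge\dots\ge v_{(n)}$ be the values in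 descending order and put $$OPT(v)=\sum_{i=1}^n v_i,\qquad \mathcal F^{(2)}(v)=\max_{2\le k\le n} k\,v_{(k)},\qquad \mathrm{maxV}(v)=\max_{1\le k<n} k\,v_{(k+1)},$$ where a maximum over an empty set is $0$. **Corollary.** For every number $n$ of bidders there is a truthful mechanism that is $1$-consistent against $OPT$ and $4.42$-robust against $\mathcal F^{(2)}$. Moreover, for every $n$ there is a truthful mechanism that is $1$-consistent against $OPT$ and $(e+1)$-robust against $\mathrm{maxV}$. -/

import Mathlib

open MeasureTheory
open scoped NNReal

noncomputable section

namespace DigitalGood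

/-- A deterministic single-round auction of a digital good to `n` bidders: every bid vector is
mapped to a set of winners (any set of bidders may be served) and to nonnegative payments.
A winner pays at most her bid and a loser pays nothing. -/
structure Auction (n : ℕ) where
  winners : (Fin n → ℝ≥0) → Finset (Fin n)
  payment : (Fin n → ℝ≥0) → Fin n → ℝ≥0
  payment_le_bid : ∀ b i, i ∈ winners b → payment b i ≤ b i
  payment_of_loser : ∀ b i, i ∉ winners b → payment b i = 0

namespace Auction

variable {n : ℕ}

/-- Quasi-linear utility of bidder `i` with private value `x` when the bids are `b`. -/
def utility (A : Auction n) (i : Fin n) (x : ℝ≥0) (b : Fin n → ℝ≥0) : ℝ :=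
  (if i ∈ A.winners b then (x : ℝ) else 0) - A.payment b i

/-- Bidding one's private value is a dominant strategy for every bidder. -/
def Truthful (A : Auction n) : Prop :=
  ∀ (v : Fin n → ℝ≥0) (i : Fin n) (z : ℝ≥0),
    A.utility i (v i) (Function.update v i z) ≤ A.utility i (v i) v

/-- Total payment collected on the bid vector `b`. -/
def revenue (A : Auction n) (b : Fin n → ℝ≥0) : ℝ :=
  ∑ i, (A.payment b i : ℝ)

end Auction

/-- A randomized auction: a probability distribution over deterministic auctions. -/
structure RandomAuction (n : ℕ) where
  Ω : Type
  [mΩ : MeasurableSpace Ω]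
  μ : Measure Ω
  isProb : IsProbabilityMeasure μ
  auction : Ω → Auction n
  measurable_winners : ∀ b i, MeasurableSet {ω | i ∈ (auction ω).winners b}
  measurable_payment : ∀ b i, Measurable fun ω => (auction ω).payment b i

namespace RandomAuction

variable {n : ℕ}

attribute [instance] RandomAuction.mΩ RandomAuction.isProb

/-- A randomized auction is truthful if it is a distribution over truthful deterministic ones. -/
def Truthful (A : RandomAuction n) : Prop :=
  ∀ ω, (A.auction ω).Truthful

/-- Expected total payment collected on the bid vector `b`. -/
def expectedRevenue (A : RandomAuction n) (b : Fin n → ℝ≥0) : ℝ :=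
  ∫ ω, (A.auction ω).revenue b ∂A.μ

/-- The integral in the expected revenue is always a genuine one. -/
theorem integrable_revenue (A : RandomAuction n) (b : Fin n → ℝ≥0) :
    Integrable (fun ω => (A.auction ω).revenue b) A.μ := by
  unfold Auction.revenue
  refine integrable_finsetSum _ fun i _ => ?_
  refine Integrable.of_bound
    (measurable_coe_nnreal_real.comp (A.measurable_payment b i)).aestronglyMeasurable
    (b i : ℝ) (Filter.Eventually.of_forall fun ω => ?_)
  have h : (A.auction ω).payment b i ≤ b i := by
    by_cases hi : i ∈ (A.auction ω).winners b
    · exact (A.auction ω).payment_le_bid b i hi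
    · rw [(A.auction ω).payment_of_loser b i hi]; exact zero_le
  simpa using h

end RandomAuction

/-- A learning-augmented mechanism: one randomized auction for every vector of predictions. -/
abbrev Mechanism (n : ℕ) : Type 1 := (Fin n → ℝ≥0) → RandomAuction n

namespace Mechanism

variable {n : ℕ}

def Truthful (M : Mechanism n) : Prop :=
  ∀ p, (M p).Truthful

/-- `c`-consistency against the benchmark `f`: the predictions `p` are the true values. -/
def Consistent (M : Mechanism n) (c : ℝ) (f : (Fin n → ℝ≥0) → ℝ≥0) : Prop :=
  ∀ p, (f p : ℝ) / c ≤ (M p).expectedRevenue p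

/-- `α`-robustness against the benchmark `f`: the predictions `p` are arbitrary. -/
def Robust (M : Mechanism n) (α : ℝ) (f : (Fin n → ℝ≥0) → ℝ≥0) : Prop :=
  ∀ p v, (f v : ℝ) / α ≤ (M p).expectedRevenue v

end Mechanism

section Benchmarks

variable {n : ℕ}

/-- The optimal revenue when the values are known and there is no feasibility constraint. -/
def OPT (v : Fin n → ℝ≥0) : ℝ≥0 := ∑ i, v i

/-- `OPT v` is the maximum of `∑ i, x i * v i` over all allocations `x` in the unit cube. -/
theorem OPT_isGreatest (v : Fin n → ℝ≥0) :
    IsGreatest {r | ∃ x : Fin n → ℝ≥0, (∀ i, x i ≤ 1) ∧ r = ∑ i, x i * v i} (OPT v) := by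
  refine ⟨⟨fun _ => 1, fun _ => le_rfl, by simp [OPT]⟩, ?_⟩
  rintro r ⟨x, hx, rfl⟩
  exact Finset.sum_le_sum fun i _ => mul_le_of_le_one_left' (hx i)

/-- The values rearranged in descending order; `desc v i` is the `(i + 1)`-st highest value. -/
def desc (v : Fin n → ℝ≥0) : Fin n → ℝ≥0 :=
  v ∘ Tuple.sort (OrderDual.toDual ∘ v)

theorem desc_antitone (v : Fin n → ℝ≥0) : Antitone (desc v) :=
  fun _ _ h => Tuple.monotone_sort (OrderDual.toDual ∘ v) h

/-- `max_{2 ≤ k ≤ n} k * v_k` for the values in descending order (`k = i + 1`). -/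
def F2 (v : Fin n → ℝ≥0) : ℝ≥0 :=
  (Finset.univ.filter fun i : Fin n => 1 ≤ (i : ℕ)).sup fun i => (((i : ℕ) + 1 : ℕ) : ℝ≥0) * desc v i

/-- `max_{k < n} k * v_{k+1}` for the values in descending order (`k = i`). -/
def maxV (v : Fin n → ℝ≥0) : ℝ≥0 :=
  Finset.univ.sup fun i : Fin n => ((i : ℕ) : ℝ≥0) * desc v i

end Benchmarks

end DigitalGood

end

/-! Each price depends only on the other bids, so truthfulness is automatic; a bidder who sees no
deviation from the predictions is offered her own prediction, so correct predictions yield `OPT`. A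
bidder who sees a deviation faces the highest other bid (Vickrey) with probability `q`, and
otherwise, as a rule, profit extraction with target `F2` of the other bids times `exp (-u)`, `u`
uniform on an interval of length `8 / 5`.

The targets differ between bidders, but expected revenue is a sum over bidders. On the log scale
every target is uniform on an interval of length `8 / 5`, and on the intersection of these intervals
the payments can be added up as if all bidders faced one common target (`exists_share`,
`le_sum_integral_sharePay`).

The obstacle is a lone deviator with the top bid: she sees no deviation, so Vickrey may earn
nothing. The state `Charged` recognises this from the viewpoint of the others, who then pay their
correct predictions with probability `q`. With two deviators both may be in that state by mistake;
the third highest value, which they pay with probability `1 - 2 * q`, makes up for their lost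
shares. `expectedRevenue_bound` collects these cases, and both robustness claims reduce to
inequalities in `k`. -/

noncomputable section

namespace DigitalGood

open scoped Finset

variable {n : ℕ}

/-! ### Order statistics and benchmarks -/

/-- The number of bidders whose value is at least `t`. -/
def count (v : Fin n → ℝ≥0) (t : ℝ≥0) : ℕ := #{j | t ≤ v j}

theorem count_le (v : Fin n → ℝ≥0) (t : ℝ≥0) : count v t ≤ n := by
  simpa [count] using Finset.card_le_univ (Finset.univ.filter fun j => t ≤ v j)

theorem count_antitone (v : Fin n → ℝ≥0) : Antitone (count v) := fun _ _ h =>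
  Finset.card_le_card (Finset.monotone_filter_right _ fun _ _ hj => h.trans hj)

theorem count_mono {v w : Fin n → ℝ≥0} (h : v ≤ w) (t : ℝ≥0) : count v t ≤ count w t :=
  Finset.card_le_card (Finset.monotone_filter_right _ fun j _ hj => hj.trans (h j))

theorem count_desc (v : Fin n → ℝ≥0) (t : ℝ≥0) : count (desc v) t = count v t := by
  unfold count
  refine Finset.card_equiv (Tuple.sort (OrderDual.toDual ∘ v)) fun j => ?_
  rw [Finset.mem_filter_univ, Finset.mem_filter_univ]
  rfl

/-- Replaces sorting by counting: from here on a benchmark is a pair `k`, `t` with enough bidders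
above the threshold `t`. The inequality is strict because `desc` is indexed from 0. -/
theorem lt_count_iff (v : Fin n → ℝ≥0) (t : ℝ≥0) (i : Fin n) :
    (i : ℕ) < count v t ↔ t ≤ desc v i := by
  rw [← count_desc]
  exact Tuple.lt_card_ge_iff_apply_ge_of_antitone (desc_antitone v)

theorem le_F2 {v : Fin n → ℝ≥0} {k : ℕ} {t : ℝ≥0} (hk : 2 ≤ k) (h : k ≤ count v t) :
    k * t ≤ F2 v := by
  have hn := h.trans (count_le v t)
  have ht : t ≤ desc v ⟨k - 1, by omega⟩ := (lt_count_iff v t _).1 (by simp; omega)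
  refine le_trans ?_ (Finset.le_sup (b := (⟨k - 1, by omega⟩ : Fin n)) ?_)
  · have : k - 1 + 1 = k := by omega
    simp only [this]
    gcongr
  · simp; omega

theorem F2_eq (v : Fin n → ℝ≥0) :
    F2 v = 0 ∨ ∃ k t, 2 ≤ k ∧ k ≤ count v t ∧ F2 v = (k : ℝ≥0) * t := by
  rcases (Finset.univ.filter fun i : Fin n => 1 ≤ (i : ℕ)).eq_empty_or_nonempty with h | h
  · left; simp [F2, h]
  · right
    obtain ⟨i, hi, h⟩ := Finset.exists_mem_eq_sup _ h
      fun i : Fin n => (((i : ℕ) + 1 : ℕ) : ℝ≥0) * desc v i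
    refine ⟨i + 1, desc v i, ?_, (lt_count_iff v _ i).2 le_rfl, h⟩
    simp at hi; omega

theorem le_maxV {v : Fin n → ℝ≥0} {k : ℕ} {t : ℝ≥0} (h : k + 1 ≤ count v t) :
    k * t ≤ maxV v := by
  have hn := h.trans (count_le v t)
  have ht : t ≤ desc v ⟨k, hn⟩ := (lt_count_iff v t _).1 h
  refine le_trans ?_ (Finset.le_sup (b := (⟨k, hn⟩ : Fin n)) (Finset.mem_univ _))
  gcongr

theorem maxV_eq (v : Fin n → ℝ≥0) :
    maxV v = 0 ∨ ∃ k t, k + 1 ≤ count v t ∧ maxV v = (k : ℝ≥0) * t := by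
  rcases (Finset.univ : Finset (Fin n)).eq_empty_or_nonempty with h | h
  · left; simp [maxV, h]
  · right
    obtain ⟨i, hi, h⟩ := Finset.exists_mem_eq_sup _ h fun i : Fin n => ((i : ℕ) : ℝ≥0) * desc v i
    exact ⟨i, desc v i, (lt_count_iff v _ i).2 le_rfl, h⟩

theorem F2_mono {v w : Fin n → ℝ≥0} (h : v ≤ w) : F2 v ≤ F2 w := by
  rcases F2_eq v with h0 | ⟨k, t, hk, hkt, he⟩
  · simp [h0]
  · rw [he]; exact le_F2 hk (hkt.trans (count_mono h t))

/-- Since `k ≤ 2 * (k - 1)` for `k ≥ 2`. This caps the targets when the benchmark is `maxV`. -/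
theorem F2_le_two_mul_maxV (v : Fin n → ℝ≥0) : F2 v ≤ 2 * maxV v := by
  rcases F2_eq v with h0 | ⟨k, t, hk, hkt, he⟩
  · simp [h0]
  · obtain ⟨m, rfl⟩ : ∃ m, k = m + 1 := ⟨k - 1, by omega⟩
    rw [he]
    refine le_trans ?_ (mul_le_mul_right (le_maxV hkt) 2)
    rw [← mul_assoc]
    gcongr
    exact_mod_cast (by omega : m + 1 ≤ 2 * m)

theorem count_le_succ_card (v : Fin n → ℝ≥0) (i : Fin n) (t : ℝ≥0) :
    count v t ≤ #{j | j ≠ i ∧ t ≤ v j} + 1 := by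
  refine (Finset.card_le_card ?_).trans (Finset.card_insert_le i _)
  intro j hj
  by_cases h : j = i <;> simp_all

theorem succ_card_eq_count {v : Fin n → ℝ≥0} {i : Fin n} {t : ℝ≥0} (h : t ≤ v i) :
    #{j | j ≠ i ∧ t ≤ v j} + 1 = count v t := by
  rw [count, ← Finset.card_insert_of_notMem (a := i) (by simp)]
  congr 1
  ext j
  by_cases hj : j = i <;> simp_all

theorem count_le_count_update (v : Fin n → ℝ≥0) (i : Fin n) (t : ℝ≥0) :
    count v t ≤ count (Function.update v i 0) t + 1 := by
  refine (count_le_succ_card v i t).trans (Nat.succ_le_succ (Finset.card_le_card ?_))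
  intro j hj
  simp_all

theorem exists_le_of_lt_card {v : Fin n → ℝ≥0} {t : ℝ≥0} {s : Finset (Fin n)}
    (h : #s < count v t) : ∃ j ∉ s, t ≤ v j := by
  obtain ⟨j, hj, hs⟩ := Finset.exists_mem_notMem_of_card_lt_card h
  exact ⟨j, hs, by simpa using hj⟩

theorem count_sub_one_mul_le_sum {v : Fin n → ℝ≥0} {t : ℝ≥0} {k : ℕ} (h : k + 1 ≤ count v t)
    (a : Fin n) : k * t ≤ ∑ j ∈ Finset.univ.erase a, v j := by
  have h1 : k ≤ #((Finset.univ.filter fun j => t ≤ v j).erase a) := by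
    have := Finset.pred_card_le_card_erase (s := Finset.univ.filter fun j => t ≤ v j) (a := a)
    unfold count at h
    omega
  calc (k : ℝ≥0) * t ≤ #((Finset.univ.filter fun j => t ≤ v j).erase a) * t := by gcongr
    _ = ∑ j ∈ (Finset.univ.filter fun j => t ≤ v j).erase a, t := by simp
    _ ≤ ∑ j ∈ (Finset.univ.filter fun j => t ≤ v j).erase a, v j :=
        Finset.sum_le_sum fun j hj => by simp at hj; exact hj.2
    _ ≤ _ := Finset.sum_le_sum_of_subset (Finset.erase_subset_erase _ (Finset.filter_subset _ _))

/-! ### Posted prices -/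

/-- The payment of a bidder with bid `y` who is offered the good at the price `x`. -/
def posted (x y : ℝ≥0) : ℝ≥0 := if x ≤ y then x else 0

theorem posted_of_le {x y : ℝ≥0} (h : x ≤ y) : posted x y = x := if_pos h

theorem posted_le (x y : ℝ≥0) : posted x y ≤ y := by
  unfold posted; split_ifs with h
  exacts [h, zero_le]

theorem measurable_posted {α : Type*} [MeasurableSpace α] {f : α → ℝ≥0} (hf : Measurable f)
    (y : ℝ≥0) : Measurable fun a => posted (f a) y :=
  Measurable.ite (hf measurableSet_Iic) hf measurable_const

/-- The auction in which every bidder is offered a price computed from the bids. -/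
def Auction.ofPrice (π : Fin n → (Fin n → ℝ≥0) → ℝ≥0) : Auction n where
  winners b := Finset.univ.filter fun i => π i b ≤ b i
  payment b i := posted (π i b) (b i)
  payment_le_bid _ _ _ := posted_le _ _
  payment_of_loser b i h := if_neg (by simpa using h)

theorem Auction.ofPrice_truthful {π : Fin n → (Fin n → ℝ≥0) → ℝ≥0}
    (h : ∀ i b z, π i (Function.update b i z) = π i b) : (Auction.ofPrice π).Truthful := by
  intro v i z
  simp only [Auction.utility, Auction.ofPrice, posted, h, Finset.mem_filter, Finset.mem_univ,
    true_and, Function.update_self]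
  split_ifs with h1 h2 h2
  · exact le_rfl
  · simpa using (not_le.1 h2).le
  · simpa using h2
  · exact le_rfl

/-! ### Profit extraction -/

/-- The number of further bidders with whom bidder `i` shares the revenue target `R`: the largest
`m` such that `m` others accept an equal share of `R`. -/
def shareCount (R : ℝ≥0) (i : Fin n) (b : Fin n → ℝ≥0) : ℕ :=
  Nat.findGreatest (fun m => m ≤ #{j | j ≠ i ∧ R / (m + 1 : ℕ) ≤ b j}) n

/-- The price offered to bidder `i` in order to extract the revenue `R`. -/
def sharePrice (R : ℝ≥0) (i : Fin n) (b : Fin n → ℝ≥0) : ℝ≥0 := R / (shareCount R i b + 1 : ℕ)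

theorem measurable_sharePrice (i : Fin n) (b : Fin n → ℝ≥0) :
    Measurable fun R => sharePrice R i b := by
  have h : Measurable fun R => shareCount R i b := by
    -- A lower target means lower shares, so no bidder stops accepting.
    refine measurable_findGreatest fun m _ => IsLowerSet.ordConnected ?_ |>.measurableSet
    intro R R' hR h
    refine le_trans (h : m ≤ _) (Finset.card_le_card ?_)
    refine Finset.monotone_filter_right _ fun j _ hj => ⟨hj.1, le_trans ?_ hj.2⟩
    gcongr
  unfold sharePrice
  have h2 : Measurable fun m : ℕ => ((m + 1 : ℕ) : ℝ≥0) := measurable_from_top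
  exact measurable_id.div (h2.comp h)

theorem shareCount_congr (R : ℝ≥0) (i : Fin n) {b b' : Fin n → ℝ≥0} (h : ∀ j, j ≠ i → b j = b' j) :
    shareCount R i b = shareCount R i b' := by
  unfold shareCount
  congr
  ext m
  have : (Finset.univ.filter fun j => j ≠ i ∧ R / (m + 1 : ℕ) ≤ b j)
      = Finset.univ.filter fun j => j ≠ i ∧ R / (m + 1 : ℕ) ≤ b' j :=
    Finset.filter_congr fun j _ => and_congr_right fun hj => by rw [h j hj]
  rw [this]

/-- Profit extraction succeeds for every target that some `k` bidders can share equally. -/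
theorem exists_share {v : Fin n → ℝ≥0} {R : ℝ≥0} {k : ℕ} (hk1 : 1 ≤ k)
    (hk : k ≤ count v (R / k)) :
    ∃ m, k ≤ m ∧ ∃ W : Finset (Fin n), #W = m ∧
      ∀ i ∈ W, posted (sharePrice R i v) (v i) = R / m := by
  set m := Nat.findGreatest (fun m : ℕ => m ≤ count v (R / m)) n with hm
  have hkm : k ≤ m := Nat.le_findGreatest (hk.trans (count_le v _)) hk
  have hmP : m ≤ count v (R / m) :=
    Nat.findGreatest_spec (P := fun m : ℕ => m ≤ count v (R / m)) (hk.trans (count_le v _)) hk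
  have hgt : ∀ m' : ℕ, m < m' → ¬ m' ≤ count v (R / m') := by
    intro m' h h'
    exact absurd (Nat.le_findGreatest (P := fun m : ℕ => m ≤ count v (R / m))
      (h'.trans (count_le v _)) h') (by omega)
  -- If more than `m` bidders accepted `R / m`, they would also accept the smaller share among all
  -- of them, against the maximality of `m`.
  have hcard : count v (R / m) = m := by
    by_contra hne
    have hlt : m < count v (R / m) := lt_of_le_of_ne hmP (Ne.symm hne)
    refine hgt _ hlt (count_antitone v ?_)
    have : (0 : ℝ≥0) < m := by exact_mod_cast (by omega : 0 < m)
    gcongr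
  refine ⟨m, hkm, Finset.univ.filter fun j => R / m ≤ v j, hcard, fun i hi => ?_⟩
  have hi : R / m ≤ v i := by simpa using hi
  -- `shareCount` leaves out bidder `i`, who accepts `R / m` herself, hence the shift by one.
  have hs : shareCount R i v = m - 1 := by
    apply le_antisymm
    · by_contra hlt
      have h0 : shareCount R i v ≤ #{j | j ≠ i ∧ R / (shareCount R i v + 1 : ℕ) ≤ v j} :=
        Nat.findGreatest_spec (P := fun m => m ≤ #{j | j ≠ i ∧ R / (m + 1 : ℕ) ≤ v j})
          (Nat.zero_le n) (Nat.zero_le _)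
      refine hgt (shareCount R i v + 1) (by omega) ?_
      rw [← succ_card_eq_count (i := i)]
      · omega
      · refine le_trans ?_ hi
        have : (0 : ℝ≥0) < m := by exact_mod_cast (by omega : 0 < m)
        gcongr
        omega
    · have hmn := hmP.trans (count_le v _)
      refine Nat.le_findGreatest (by omega) ?_
      have h1 : m - 1 + 1 = m := by omega
      rw [h1]
      have := succ_card_eq_count hi
      omega
  have h1 : m - 1 + 1 = m := by omega
  rw [sharePrice, hs, h1, posted_of_le hi]

/-! ### Expected revenue of randomized profit extraction -/

/-- The payment of bidder `i` when profit extraction is run with the revenue target `exp s`. -/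
def sharePay (v : Fin n → ℝ≥0) (i : Fin n) (s : ℝ) : ℝ :=
  posted (sharePrice (Real.toNNReal (Real.exp s)) i v) (v i)

theorem sharePay_nonneg (v : Fin n → ℝ≥0) (i : Fin n) (s : ℝ) : 0 ≤ sharePay v i s :=
  NNReal.coe_nonneg _

theorem intervalIntegrable_of_bound {f : ℝ → ℝ≥0} (hf : Measurable f) {C : ℝ≥0}
    (hC : ∀ x, f x ≤ C) (a b : ℝ) : IntervalIntegrable (fun x => (f x : ℝ)) volume a b := by
  refine (intervalIntegrable_const (c := (C : ℝ))).mono_fun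
    hf.coe_nnreal_real.aestronglyMeasurable (Filter.Eventually.of_forall fun x => ?_)
  simpa using hC x

theorem measurable_toNNReal_exp : Measurable fun s : ℝ => Real.toNNReal (Real.exp s) :=
  Real.measurable_exp.real_toNNReal

theorem intervalIntegrable_sharePay (v : Fin n → ℝ≥0) (i : Fin n) (a b : ℝ) :
    IntervalIntegrable (sharePay v i) volume a b :=
  intervalIntegrable_of_bound
    (measurable_posted ((measurable_sharePrice i v).comp measurable_toNNReal_exp) (v i))
    (fun _ => posted_le _ _) a b

/-- Extraction has `r ≥ k` winners with equal shares, of whom at most `m` lie outside `S`; the lost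
fraction is at most `m / r ≤ m / k`. -/
theorem le_sum_sharePay {v : Fin n → ℝ≥0} {t : ℝ≥0} {k m : ℕ} {s : ℝ} (S : Finset (Fin n))
    (hk1 : 1 ≤ k) (hk : k ≤ count v t) (hm : m ≤ k) (hS : #Sᶜ ≤ m) (hs : Real.exp s ≤ k * t) :
    (1 - (m : ℝ) / k) * Real.exp s ≤ ∑ i ∈ S, sharePay v i s := by
  have hk0 : (0 : ℝ) < k := by exact_mod_cast hk1
  obtain ⟨r, hkr, W, hW, hpay⟩ := exists_share (v := v) (R := Real.toNNReal (Real.exp s)) hk1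
    (hk.trans (count_antitone v (by
      rw [div_le_iff₀ (by exact_mod_cast hk1)]
      rw [Real.toNNReal_le_iff_le_coe]
      push_cast
      linarith)))
  have hr0 : (0 : ℝ) < r := hk0.trans_le (by exact_mod_cast hkr)
  have hcard : r - m ≤ #(S ∩ W) := by
    have h1 : #(W \ S) ≤ #Sᶜ := Finset.card_le_card fun x hx => by simp_all
    have h2 := Finset.card_sdiff_add_card_inter W S
    rw [Finset.inter_comm] at h2
    omega
  have hcard' : (r : ℝ) - m ≤ #(S ∩ W) := by
    have : r ≤ #(S ∩ W) + m := by omega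
    have : (r : ℝ) ≤ #(S ∩ W) + m := by exact_mod_cast this
    linarith
  have he : ∀ i ∈ S ∩ W, sharePay v i s = Real.exp s / r := by
    intro i hi
    rw [sharePay, hpay i (Finset.mem_inter.1 hi).2]
    push_cast
    rw [Real.coe_toNNReal _ (Real.exp_pos s).le]
  calc (1 - (m : ℝ) / k) * Real.exp s ≤ (1 - (m : ℝ) / r) * Real.exp s := by
        have : (k : ℝ) ≤ r := by exact_mod_cast hkr
        gcongr
    _ = (r - m) * (Real.exp s / r) := by field_simp
    _ ≤ #(S ∩ W) * (Real.exp s / r) := by gcongr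
    _ = ∑ i ∈ S ∩ W, sharePay v i s := by rw [Finset.sum_congr rfl he]; simp
    _ ≤ ∑ i ∈ S, sharePay v i s :=
        Finset.sum_le_sum_of_subset_of_nonneg Finset.inter_subset_left
          fun i _ _ => sharePay_nonneg v i s

theorem exp_neg_eight_fifths_le : Real.exp (-(8 / 5)) ≤ 0.202 := by
  have h1 : (4.951 : ℝ) ≤ Real.exp (8 / 5) := by
    refine le_of_pow_le_pow_left₀ (n := 5) (by norm_num) (Real.exp_pos _).le ?_
    -- The fifth power reduces the bound to the known decimals of `e`.
    have h8 : Real.exp (8 / 5) ^ 5 = Real.exp 1 ^ 8 := by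
      rw [← Real.exp_nat_mul, ← Real.exp_nat_mul]; norm_num
    rw [h8]
    calc (4.951 : ℝ) ^ 5 ≤ 2.7182818283 ^ 8 := by norm_num
      _ ≤ _ := by gcongr; exact Real.exp_one_gt_d9.le
  rw [Real.exp_neg, inv_le_comm₀ (Real.exp_pos _) (by norm_num)]
  exact le_trans (by norm_num) h1

/-- All the intervals contain `[log hi - 8/5, log lo]`, nonempty because `hi ≤ 2 * lo`. Dropping the
rest leaves a common target `exp s`, whose integral there is `lo - exp (-8/5) * hi`. -/
theorem le_sum_integral_sharePay {v : Fin n → ℝ≥0} {t : ℝ≥0} {k m : ℕ} {lo hi : ℝ}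
    (S : Finset (Fin n)) (E : Fin n → ℝ) (hk1 : 1 ≤ k) (hk : k ≤ count v t) (hm : m ≤ k)
    (hS : #Sᶜ ≤ m) (hlo0 : 0 < lo) (hlo : ∀ i ∈ S, lo ≤ E i) (hhi : ∀ i ∈ S, E i ≤ hi)
    (hlh : lo ≤ hi) (hhl : hi ≤ 2 * lo) (hkt : lo ≤ k * t) :
    (1 - (m : ℝ) / k) * (lo - 0.202 * hi) ≤
      ∑ i ∈ S, ∫ s in (Real.log (E i) - 8 / 5)..(Real.log (E i)), sharePay v i s := by
  have hhi0 : 0 < hi := hlo0.trans_le hlh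
  have hmk : 0 ≤ 1 - (m : ℝ) / k := by
    rw [sub_nonneg, div_le_one (by exact_mod_cast hk1)]
    exact_mod_cast hm
  have hexp := exp_neg_eight_fifths_le
  have hexphi : Real.exp (Real.log hi - 8 / 5) = hi * Real.exp (-(8 / 5)) := by
    rw [sub_eq_add_neg, Real.exp_add, Real.exp_log hhi0]
  have hab : Real.log hi - 8 / 5 ≤ Real.log lo := by
    rw [Real.le_log_iff_exp_le hlo0, hexphi]
    nlinarith
  calc (1 - (m : ℝ) / k) * (lo - 0.202 * hi)
      ≤ (1 - (m : ℝ) / k) * (lo - hi * Real.exp (-(8 / 5))) := by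
        gcongr ?_ * (_ - ?_)
        nlinarith
    _ = ∫ s in (Real.log hi - 8 / 5)..(Real.log lo), (1 - (m : ℝ) / k) * Real.exp s := by
        rw [intervalIntegral.integral_const_mul, integral_exp, hexphi, Real.exp_log hlo0]
    _ ≤ ∫ s in (Real.log hi - 8 / 5)..(Real.log lo), ∑ i ∈ S, sharePay v i s := by
        refine intervalIntegral.integral_mono_on hab
          ((Real.continuous_exp.const_mul _).intervalIntegrable _ _) ?_ fun s hs => ?_
        · simpa only [Finset.sum_fn] using
            IntervalIntegrable.sum S fun i _ => intervalIntegrable_sharePay v i _ _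
        · refine le_sum_sharePay S hk1 hk hm hS (le_trans ?_ hkt)
          rw [← Real.le_log_iff_exp_le hlo0]
          exact hs.2
    _ = ∑ i ∈ S, ∫ s in (Real.log hi - 8 / 5)..(Real.log lo), sharePay v i s :=
        intervalIntegral.integral_finsetSum fun i _ => intervalIntegrable_sharePay v i _ _
    _ ≤ _ := by
        refine Finset.sum_le_sum fun i hi' => ?_
        have h1 := Real.log_le_log hlo0 (hlo i hi')
        have h2 := Real.log_le_log (hlo0.trans_le (hlo i hi')) (hhi i hi')
        exact intervalIntegral.integral_mono_interval (by linarith) hab h1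
          (Filter.Eventually.of_forall fun s => sharePay_nonneg v i s)
          (intervalIntegrable_sharePay v i _ _)

/-! ### The mechanism -/

/-- The other bidders whose bids differ from their predictions. -/
def deviators (p : Fin n → ℝ≥0) (i : Fin n) (b : Fin n → ℝ≥0) : Finset (Fin n) :=
  {j | j ≠ i ∧ b j ≠ p j}

/-- Among the other bidders exactly one deviates from the prediction, with a bid that exceeds all
remaining predictions, including the one for bidder `i`. -/
def Charged (p : Fin n → ℝ≥0) (i : Fin n) (b : Fin n → ℝ≥0) : Prop :=
  ∃ a, deviators p i b = {a} ∧ ∀ j, j ≠ a → p j < b a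

open scoped Classical in
/-- The price offered to bidder `i` under the prediction `p`, for the random seed `ω ∈ (0, 1]`. -/
def price (p : Fin n → ℝ≥0) (q ω : ℝ) (i : Fin n) (b : Fin n → ℝ≥0) : ℝ≥0 :=
  if deviators p i b = ∅ then p i
  else if ω ≤ q then (Finset.univ.erase i).sup b
  else if Charged p i b then
    if ω ≤ 2 * q then p i else (Finset.univ.erase i \ deviators p i b).sup b
  else sharePrice (F2 (Function.update b i 0) *
    Real.toNNReal (Real.exp (-(8 / 5 * ((ω - q) / (1 - q)))))) i b

theorem deviators_congr (p : Fin n → ℝ≥0) {i : Fin n} {b b' : Fin n → ℝ≥0}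
    (h : ∀ j, j ≠ i → b j = b' j) : deviators p i b = deviators p i b' :=
  Finset.filter_congr fun j _ => and_congr_right fun hj => by rw [h j hj]

/-- The bid of `i` is never read: `deviators` and both suprema omit it, `Charged` reads only the bid
of a deviator other than `i`, and `F2` is taken with it set to 0. -/
theorem price_update (p : Fin n → ℝ≥0) (q ω : ℝ) (i : Fin n) (b : Fin n → ℝ≥0) (z : ℝ≥0) :
    price p q ω i (Function.update b i z) = price p q ω i b := by
  have h : ∀ j, j ≠ i → Function.update b i z j = b j := fun j hj => Function.update_of_ne hj _ _
  have hd := deviators_congr p h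
  have hc : Charged p i (Function.update b i z) ↔ Charged p i b := by
    unfold Charged
    rw [hd]
    refine exists_congr fun a => and_congr_right fun ha => ?_
    have : a ∈ deviators p i b := by simp [ha]
    rw [h a (by simp [deviators] at this; exact this.1)]
  have hs : ∀ s : Finset (Fin n), s ⊆ Finset.univ.erase i →
      s.sup (Function.update b i z) = s.sup b := fun s hs =>
    Finset.sup_congr rfl fun j hj => h j (Finset.ne_of_mem_erase (hs hj))
  unfold price
  rw [hd, hs _ subset_rfl, hs _ Finset.sdiff_subset, Function.update_idem]
  by_cases hb : Charged p i b
  · simp only [hb, hc.2 hb, if_true]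
  · simp only [hb, mt hc.1 hb, sharePrice, shareCount_congr _ i h]

theorem measurable_price (p : Fin n → ℝ≥0) (q : ℝ) (i : Fin n) (b : Fin n → ℝ≥0) :
    Measurable fun ω => price p q ω i b := by
  unfold price
  refine Measurable.ite (MeasurableSet.const _) measurable_const ?_
  refine Measurable.ite measurableSet_Iic measurable_const ?_
  refine Measurable.ite (MeasurableSet.const _)
    (Measurable.ite measurableSet_Iic measurable_const measurable_const) ?_
  refine (measurable_sharePrice i b).comp (measurable_const.mul ?_)
  exact measurable_toNNReal_exp.comp (by fun_prop)

/-- The learning-augmented mechanism with the prices `price`. -/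
def mechanism (q : ℝ) : Mechanism n := fun p =>
  { Ω := ℝ
    μ := volume.restrict (Set.Ioc 0 1)
    isProb := ⟨by simp⟩
    auction := fun ω => Auction.ofPrice (price p q ω)
    measurable_winners := fun b i => by
      have h : MeasurableSet {ω | price p q ω i b ≤ b i} :=
        measurable_price p q i b measurableSet_Iic
      simpa only [Auction.ofPrice, Finset.mem_filter_univ] using h
    measurable_payment := fun b i => measurable_posted (measurable_price p q i b) (b i) }

theorem mechanism_truthful (q : ℝ) : (mechanism q : Mechanism n).Truthful := fun p ω =>
  Auction.ofPrice_truthful fun i b z => price_update p q ω i b z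

/-- The payment of bidder `i` for the seed `ω`. -/
def pay (p : Fin n → ℝ≥0) (q : ℝ) (v : Fin n → ℝ≥0) (i : Fin n) (ω : ℝ) : ℝ :=
  posted (price p q ω i v) (v i)

theorem pay_nonneg (p : Fin n → ℝ≥0) (q : ℝ) (v : Fin n → ℝ≥0) (i : Fin n) (ω : ℝ) :
    0 ≤ pay p q v i ω := NNReal.coe_nonneg _

theorem intervalIntegrable_pay (p : Fin n → ℝ≥0) (q : ℝ) (v : Fin n → ℝ≥0) (i : Fin n) (a b : ℝ) :
    IntervalIntegrable (pay p q v i) volume a b :=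
  intervalIntegrable_of_bound (measurable_posted (measurable_price p q i v) (v i)) (fun _ => posted_le _ _) a b

theorem expectedRevenue_mechanism (p : Fin n → ℝ≥0) (q : ℝ) (v : Fin n → ℝ≥0) :
    (mechanism q p).expectedRevenue v = ∑ i, ∫ ω in (0 : ℝ)..1, pay p q v i ω := by
  rw [← intervalIntegral.integral_finsetSum fun i _ => intervalIntegrable_pay p q v i _ _,
    intervalIntegral.integral_of_le zero_le_one]
  rfl

/-! ### Expected payments in each branch of the price. -/

theorem integral_pay_nonneg (p : Fin n → ℝ≥0) (q : ℝ) (v : Fin n → ℝ≥0) (i : Fin n) {a b : ℝ}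
    (hab : a ≤ b) : 0 ≤ ∫ ω in a..b, pay p q v i ω :=
  intervalIntegral.integral_nonneg hab fun _ _ => pay_nonneg _ _ _ _ _

theorem integral_pay_split (p : Fin n → ℝ≥0) (q : ℝ) (v : Fin n → ℝ≥0) (i : Fin n) (a b c : ℝ) :
    ∫ ω in a..c, pay p q v i ω =
      (∫ ω in a..b, pay p q v i ω) + ∫ ω in b..c, pay p q v i ω :=
  (intervalIntegral.integral_add_adjacent_intervals (intervalIntegrable_pay _ _ _ _ _ _)
    (intervalIntegrable_pay _ _ _ _ _ _)).symm

theorem integral_pay_of_price_eq {p : Fin n → ℝ≥0} {q : ℝ} {v : Fin n → ℝ≥0} {i : Fin n} {a b : ℝ}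
    {x : ℝ≥0} (hab : a ≤ b) (h : ∀ ω, a < ω → ω ≤ b → price p q ω i v = x) :
    ∫ ω in a..b, pay p q v i ω = (b - a) * posted x (v i) := by
  rw [intervalIntegral.integral_congr_ae (g := fun _ => ((posted x (v i) : ℝ≥0) : ℝ))
    (Filter.Eventually.of_forall fun ω hω => ?_)]
  · simp
  · rw [Set.uIoc_of_le hab] at hω
    rw [pay, h ω hω.1 hω.2]

theorem integral_pay_of_no_deviators {p : Fin n → ℝ≥0} {q : ℝ} {v : Fin n → ℝ≥0} {i : Fin n}
    (hd : deviators p i v = ∅) : ∫ ω in (0 : ℝ)..1, pay p q v i ω = posted (p i) (v i) := by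
  rw [integral_pay_of_price_eq zero_le_one (x := p i)]
  · simp
  · intro ω _ _; simp [price, hd]

theorem integral_pay_vickrey {p : Fin n → ℝ≥0} {q : ℝ} {v : Fin n → ℝ≥0} {i : Fin n}
    (hq : 0 ≤ q) (hd : deviators p i v ≠ ∅) :
    ∫ ω in (0 : ℝ)..q, pay p q v i ω = q * posted ((Finset.univ.erase i).sup v) (v i) := by
  rw [integral_pay_of_price_eq hq (x := (Finset.univ.erase i).sup v)]
  · simp
  · intro ω _ h; simp [price, hd, h]

theorem integral_pay_charge {p : Fin n → ℝ≥0} {q : ℝ} {v : Fin n → ℝ≥0} {i : Fin n}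
    (hq : 0 ≤ q) (hc : Charged p i v) :
    ∫ ω in q..(2 * q), pay p q v i ω = q * posted (p i) (v i) := by
  have hd : deviators p i v ≠ ∅ := by obtain ⟨a, ha, _⟩ := hc; simp [ha]
  rw [integral_pay_of_price_eq (by linarith) (x := p i)]
  · ring
  · intro ω h h'; simp [price, hd, h.not_ge, hc, h']

theorem integral_pay_third {p : Fin n → ℝ≥0} {q : ℝ} {v : Fin n → ℝ≥0} {i : Fin n}
    (hq : 0 ≤ q) (hq1 : 2 * q ≤ 1) (hc : Charged p i v) :
    ∫ ω in (2 * q)..1, pay p q v i ω =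
      (1 - 2 * q) * posted ((Finset.univ.erase i \ deviators p i v).sup v) (v i) := by
  have hd : deviators p i v ≠ ∅ := by obtain ⟨a, ha, _⟩ := hc; simp [ha]
  refine integral_pay_of_price_eq hq1 fun ω h h' => ?_
  have h2 : ¬ ω ≤ q := by linarith
  simp [price, hd, h.not_ge, hc, h2]

/-- Substitution `s = log E - 8/5 * (ω - q) / (1 - q)`, under which the target becomes `exp s`. -/
theorem integral_pay_share {p : Fin n → ℝ≥0} {q : ℝ} {v : Fin n → ℝ≥0} {i : Fin n}
    (hq1 : q < 1) (hd : deviators p i v ≠ ∅) (hc : ¬ Charged p i v)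
    (hE : 0 < F2 (Function.update v i 0)) :
    ∫ ω in q..1, pay p q v i ω = (1 - q) / (8 / 5) *
      ∫ s in (Real.log (F2 (Function.update v i 0)) - 8 / 5)..
        (Real.log (F2 (Function.update v i 0))), sharePay v i s := by
  set E := F2 (Function.update v i 0) with hEdef
  have h1q : 1 - q ≠ 0 := by linarith
  have hc0 : 8 / 5 / (1 - q) ≠ 0 := div_ne_zero (by norm_num) h1q
  have h := intervalIntegral.integral_comp_sub_mul (a := q) (b := 1) (sharePay v i) hc0
    (Real.log E + 8 / 5 / (1 - q) * q)
  have e1 : Real.log E + 8 / 5 / (1 - q) * q - 8 / 5 / (1 - q) * 1 = Real.log E - 8 / 5 := by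
    field_simp; ring
  have e2 : Real.log E + 8 / 5 / (1 - q) * q - 8 / 5 / (1 - q) * q = Real.log E := by ring
  rw [e1, e2, inv_div, smul_eq_mul] at h
  rw [← h]
  refine intervalIntegral.integral_congr_ae (Filter.Eventually.of_forall fun ω hω => ?_)
  rw [Set.uIoc_of_le hq1.le] at hω
  have e3 : Real.log E + 8 / 5 / (1 - q) * q - 8 / 5 / (1 - q) * ω
      = Real.log E + -(8 / 5 * ((ω - q) / (1 - q))) := by field_simp; ring
  have e4 : Real.toNNReal (Real.exp (Real.log E + -(8 / 5 * ((ω - q) / (1 - q))))) =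
      E * Real.toNNReal (Real.exp (-(8 / 5 * ((ω - q) / (1 - q))))) := by
    rw [Real.exp_add, Real.toNNReal_mul (Real.exp_pos _).le, Real.exp_log (by exact_mod_cast hE),
      Real.toNNReal_coe]
  rw [e3, sharePay, e4, pay]
  simp [price, hd, hω.1.not_ge, hc, hEdef]

/-! ### Revenue bounds -/

theorem sum_vickrey_le {p : Fin n → ℝ≥0} {q : ℝ} {v : Fin n → ℝ≥0} {T : Fin n} {t : ℝ≥0}
    (hq : 0 ≤ q) (hT : ∀ j, v j ≤ v T) (hd : deviators p T v ≠ ∅) (ht : 2 ≤ count v t) :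
    q * t ≤ ∑ i, ∫ ω in (0 : ℝ)..q, pay p q v i ω := by
  obtain ⟨j, hj, hjt⟩ := exists_le_of_lt_card (v := v) (t := t) (s := {T}) (by simp; omega)
  have hM : t ≤ (Finset.univ.erase T).sup v :=
    hjt.trans (Finset.le_sup (f := v) (by simpa using hj))
  calc q * t ≤ q * ((Finset.univ.erase T).sup v : ℝ≥0) := by gcongr
    _ = ∫ ω in (0 : ℝ)..q, pay p q v T ω := by
        rw [integral_pay_vickrey hq hd, posted_of_le (Finset.sup_le fun j _ => hT j)]
    _ ≤ _ := Finset.single_le_sum (f := fun i => ∫ ω in (0 : ℝ)..q, pay p q v i ω)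
        (fun i _ => integral_pay_nonneg p q v i hq) (Finset.mem_univ T)

theorem le_sum_share {p : Fin n → ℝ≥0} {q : ℝ} {v : Fin n → ℝ≥0} {t : ℝ≥0} {k m : ℕ} {lo hi : ℝ}
    (S : Finset (Fin n)) (hq1 : q < 1)
    (hd : ∀ i ∈ S, deviators p i v ≠ ∅ ∧ ¬ Charged p i v) (hS : #Sᶜ ≤ m)
    (hk1 : 1 ≤ k) (hk : k ≤ count v t) (hm : m ≤ k) (hlo0 : 0 < lo)
    (hE : ∀ i, lo ≤ F2 (Function.update v i 0) ∧ F2 (Function.update v i 0) ≤ hi)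
    (hlh : lo ≤ hi) (hhl : hi ≤ 2 * lo) (hkt : lo ≤ k * t) :
    (1 - q) / (8 / 5) * ((1 - (m : ℝ) / k) * (lo - 0.202 * hi)) ≤
      ∑ i ∈ S, ∫ ω in q..1, pay p q v i ω := by
  have h := le_sum_integral_sharePay S (fun i => (F2 (Function.update v i 0) : ℝ)) hk1 hk hm hS hlo0
    (fun i _ => (hE i).1) (fun i _ => (hE i).2) hlh hhl hkt
  rw [Finset.sum_congr rfl fun i hi => integral_pay_share hq1 (hd i hi).1 (hd i hi).2
    (by exact_mod_cast hlo0.trans_le (hE i).1), ← Finset.mul_sum]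
  have : 0 ≤ (1 - q) / (8 / 5) := by apply div_nonneg <;> linarith
  gcongr

theorem deviators_eq_erase (p v : Fin n → ℝ≥0) (i : Fin n) :
    deviators p i v = (Finset.univ.filter fun j => v j ≠ p j).erase i := by
  ext j; simp [deviators]

/-- The revenue when the prediction is wrong. Either a single bidder deviates from her prediction
and the others are charged their own values; or the second highest value is collected together
with the revenue of profit extraction, up to the share of one bidder; or, if two bidders
deviate, up to the shares of two bidders who pay the third highest value instead. -/
theorem expectedRevenue_bound {p v : Fin n → ℝ≥0} {q : ℝ} (hq : 0 ≤ q) (hq1 : 2 * q < 1)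
    (hpv : v ≠ p) {k : ℕ} {t : ℝ≥0} (hk2 : 2 ≤ k) (hk : k ≤ count v t) :
    (∃ a, q * ∑ j ∈ Finset.univ.erase a, (v j : ℝ) ≤ (mechanism q p).expectedRevenue v) ∨
    (q * t ≤ (mechanism q p).expectedRevenue v ∧
      ∀ lo hi : ℝ, 3 ≤ k → 0 < lo →
        (∀ i, lo ≤ F2 (Function.update v i 0) ∧ F2 (Function.update v i 0) ≤ hi) →
        lo ≤ hi → hi ≤ 2 * lo → lo ≤ k * t →
        (q * t + (1 - q) / (8 / 5) * ((1 - 1 / k) * (lo - 0.202 * hi)) ≤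
            (mechanism q p).expectedRevenue v ∨
          q * t + 2 * ((1 - 2 * q) * t) + (1 - q) / (8 / 5) * ((1 - 2 / k) * (lo - 0.202 * hi)) ≤
            (mechanism q p).expectedRevenue v)) := by
  classical
  have hqlt : q < 1 := by linarith
  set A : Fin n → ℝ := fun i => ∫ ω in (0 : ℝ)..q, pay p q v i ω with hA
  set B : Fin n → ℝ := fun i => ∫ ω in q..1, pay p q v i ω with hB
  have hA0 : ∀ i, 0 ≤ A i := fun i => integral_pay_nonneg p q v i hq
  have hB0 : ∀ i, 0 ≤ B i := fun i => integral_pay_nonneg p q v i hqlt.le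
  have hrev : (mechanism q p).expectedRevenue v = ∑ i, A i + ∑ i, B i := by
    rw [expectedRevenue_mechanism, ← Finset.sum_add_distrib]
    exact Finset.sum_congr rfl fun i _ => integral_pay_split p q v i 0 q 1
  have hBS : ∀ S : Finset (Fin n), ∑ i ∈ S, B i ≤ ∑ i, B i := fun S =>
    Finset.sum_le_sum_of_subset_of_nonneg (Finset.subset_univ S) fun i _ _ => hB0 i
  set D := Finset.univ.filter fun j => v j ≠ p j with hDdef
  have hdev : ∀ i, deviators p i v = D.erase i := deviators_eq_erase p v
  have hnD : ∀ j, j ∉ D → v j = p j := fun j hj => by simpa [hDdef] using hj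
  have hDne : D.Nonempty := by
    rw [Finset.nonempty_iff_ne_empty]
    exact fun h => hpv (funext fun j => hnD j (by simp [h]))
  rw [hrev]
  -- the conclusion from one set of bidders for whom profit extraction is run
  have one (T : Fin n) (hT : ∀ j, v j ≤ v T) (hTd : deviators p T v ≠ ∅) (S : Finset (Fin n))
      (hS : ∀ i ∈ S, deviators p i v ≠ ∅ ∧ ¬ Charged p i v) (hSc : #Sᶜ ≤ 1) :
      q * t ≤ ∑ i, A i + ∑ i, B i ∧
      ∀ lo hi : ℝ, 3 ≤ k → 0 < lo →
        (∀ i, lo ≤ F2 (Function.update v i 0) ∧ F2 (Function.update v i 0) ≤ hi) →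
        lo ≤ hi → hi ≤ 2 * lo → lo ≤ k * t →
        (q * t + (1 - q) / (8 / 5) * ((1 - 1 / k) * (lo - 0.202 * hi)) ≤
            ∑ i, A i + ∑ i, B i ∨
          q * t + 2 * ((1 - 2 * q) * t) + (1 - q) / (8 / 5) * ((1 - 2 / k) * (lo - 0.202 * hi)) ≤
            ∑ i, A i + ∑ i, B i) := by
    have hV : q * t ≤ ∑ i, A i := sum_vickrey_le hq hT hTd (hk2.trans hk)
    refine ⟨hV.trans (le_add_of_nonneg_right (Finset.sum_nonneg fun i _ => hB0 i)), ?_⟩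
    intro lo hi hk3 hlo0 hE hlh hhl hkt
    left
    have h := le_sum_share (m := 1) S hqlt hS hSc (by omega) hk (by omega) hlo0 hE hlh hhl hkt
    rw [Nat.cast_one] at h
    linarith [hBS S]
  rcases hDne.exists_eq_singleton_or_nontrivial with ⟨a, hDa⟩ | hD2
  · have hva : ∀ j, j ≠ a → v j = p j := fun j hj => hnD j (by simpa [hDa] using hj)
    have hdeva : ∀ j, j ≠ a → deviators p j v = {a} := fun j hj => by
      rw [hdev, hDa, Finset.erase_eq_of_notMem (by simpa using hj)]
    -- If the lone deviator is strictly on top, everybody else is `Charged`. If not, nobody else is,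
    -- and a top bidder other than `a` pays the Vickrey price.
    by_cases htop : ∀ j, j ≠ a → p j < v a
    · left
      refine ⟨a, ?_⟩
      have h1 : ∀ j ∈ Finset.univ.erase a, q * (v j : ℝ) ≤ B j := by
        intro j hj
        have hj' := Finset.ne_of_mem_erase hj
        have hc : Charged p j v := ⟨a, hdeva j hj', htop⟩
        have h2 := integral_pay_nonneg p q v j hq1.le
        simp only [hB]
        rw [integral_pay_split p q v j q (2 * q) 1, integral_pay_charge hq hc,
          posted_of_le (hva j hj').ge, hva j hj']
        linarith
      rw [Finset.mul_sum]
      have := Finset.sum_le_sum h1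
      linarith [hBS (Finset.univ.erase a), Finset.sum_nonneg fun i (_ : i ∈ Finset.univ) => hA0 i]
    · right
      push Not at htop
      obtain ⟨j, hja, hj⟩ := htop
      obtain ⟨T, hT, hTmax⟩ := Finset.exists_max_image (Finset.univ.erase a) v ⟨j, by simpa using hja⟩
      have hjT : v a ≤ v T := by
        refine hj.trans ?_
        rw [← hva j hja]
        exact hTmax j (by simpa using hja)
      refine one T (fun i => ?_) (by simp [hdeva T (Finset.ne_of_mem_erase hT)])
        (Finset.univ.erase a) (fun i hi => ?_) (by simp [Finset.compl_erase])
      · by_cases hi : i = a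
        · rw [hi]; exact hjT
        · exact hTmax i (by simpa using hi)
      · have hd := hdeva i (Finset.ne_of_mem_erase hi)
        refine ⟨by simp [hd], ?_⟩
        rintro ⟨a', ha', h⟩
        obtain rfl : a = a' := by simpa [hd] using ha'
        exact (h j hja).not_ge hj
  · right
    have hcard : 2 ≤ #D := Finset.one_lt_card_iff_nontrivial.2 hD2
    have hdne : ∀ i, deviators p i v ≠ ∅ := fun i => by
      rw [hdev, ← Finset.nonempty_iff_ne_empty, ← Finset.card_pos]
      have := Finset.pred_card_le_card_erase (s := D) (a := i)
      omega
    -- A non-deviator sees all of `D`, hence at least two deviators.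
    have hcD : ∀ i, Charged p i v → i ∈ D := by
      rintro i ⟨a, ha, -⟩
      by_contra hi
      rw [hdev, Finset.erase_eq_of_notMem hi] at ha
      simp [ha] at hcard
    obtain ⟨T, -, hT⟩ := Finset.exists_max_image Finset.univ v
      (hDne.mono (Finset.subset_univ D))
    replace hT : ∀ j, v j ≤ v T := fun j => hT j (Finset.mem_univ j)
    by_cases hone : #(Finset.univ.filter fun i => Charged p i v) ≤ 1
    · refine one T hT (hdne T) (Finset.univ.filter fun i => ¬ Charged p i v)
        (fun i hi => ⟨hdne i, by simpa using hi⟩) ?_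
      rw [Finset.compl_filter]
      simpa only [not_not] using hone
    · have hV : q * t ≤ ∑ i, A i := sum_vickrey_le hq hT (hdne T) (hk2.trans hk)
      refine ⟨hV.trans (le_add_of_nonneg_right (Finset.sum_nonneg fun i _ => hB0 i)), ?_⟩
      intro lo hi hk3 hlo0 hE hlh hhl hkt
      right
      obtain ⟨a, ha, b, hb, hab⟩ := Finset.one_lt_card.1 (not_le.1 hone)
      replace ha : Charged p a v := by simpa using ha
      replace hb : Charged p b v := by simpa using hb
      have key : ∀ a b : Fin n, a ≠ b → Charged p a v → Charged p b v →
          deviators p a v = {b} ∧ ∀ j, j ≠ b → p j < v b := by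
        intro a b hab ha hb
        obtain ⟨x, hx, hx'⟩ := ha
        obtain rfl : b = x := by
          have : b ∈ deviators p a v := by
            rw [hdev]; exact Finset.mem_erase.2 ⟨hab.symm, hcD b hb⟩
          simpa [hx] using this
        exact ⟨hx, hx'⟩
      -- Here `D` consists of the two charged bidders, each bidding above all predictions of
      -- non-deviators. So each accepts the highest non-deviating bid, which is at least `t` since
      -- `k ≥ 3`.
      have third : ∀ a b : Fin n, a ≠ b → Charged p a v → Charged p b v →
          (1 - 2 * q) * t ≤ B a := by
        intro a b hab ha hb
        obtain ⟨h1, -⟩ := key a b hab ha hb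
        obtain ⟨h2, h3⟩ := key b a hab.symm hb ha
        have hle : (Finset.univ.erase a \ deviators p a v).sup v ≤ v a := by
          refine Finset.sup_le fun j hj => ?_
          have hj' : j ∉ D := fun h => by
            simp [hdev] at hj
            exact hj.2 hj.1 h
          rw [hnD j hj']
          exact (h3 j (by simp at hj; exact hj.1)).le
        have ht : t ≤ (Finset.univ.erase a \ deviators p a v).sup v := by
          obtain ⟨j, hj, hjt⟩ := exists_le_of_lt_card (v := v) (t := t) (s := {a, b})
            (lt_of_le_of_lt Finset.card_le_two (by omega))
          refine hjt.trans (Finset.le_sup (f := v) ?_)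
          simpa [h1] using hj
        have h4 := integral_pay_nonneg p q v a (by linarith : q ≤ 2 * q)
        simp only [hB]
        rw [integral_pay_split p q v a q (2 * q) 1, integral_pay_third hq hq1.le ha,
          posted_of_le hle]
        have : (t : ℝ) ≤ ((Finset.univ.erase a \ deviators p a v).sup v : ℝ≥0) := by
          exact_mod_cast ht
        nlinarith
      have hS : ∀ i ∈ ({a, b} : Finset (Fin n))ᶜ, deviators p i v ≠ ∅ ∧ ¬ Charged p i v := by
        intro i hi
        refine ⟨hdne i, fun hc => ?_⟩
        have h1 := (key a b hab ha hb).1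
        have : i ∈ deviators p a v := by
          rw [hdev]
          refine Finset.mem_erase.2 ⟨?_, hcD i hc⟩
          simp at hi; exact hi.1
        simp [h1] at this
        simp [this] at hi
      have h := le_sum_share (m := 2) _ hqlt hS (by rw [compl_compl]; exact Finset.card_le_two)
        (by omega) hk (by omega) hlo0 hE hlh hhl hkt
      have hsum : ∑ i, B i = B a + B b + ∑ i ∈ ({a, b} : Finset (Fin n))ᶜ, B i := by
        rw [← Finset.sum_add_sum_compl {a, b}, Finset.sum_pair hab]
      have h5 := third a b hab ha hb
      have h6 := third b a hab.symm hb ha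
      rw [Nat.cast_ofNat] at h
      linarith

/-! ### Consistency and the two robustness constants. -/

theorem expectedRevenue_self (p : Fin n → ℝ≥0) (q : ℝ) :
    (mechanism q p).expectedRevenue p = OPT p := by
  rw [expectedRevenue_mechanism, OPT, NNReal.coe_sum]
  refine Finset.sum_congr rfl fun i _ => ?_
  rw [integral_pay_of_no_deviators (by simp [deviators]), posted_of_le le_rfl]

theorem mechanism_consistent (q : ℝ) : (mechanism q : Mechanism n).Consistent 1 OPT := fun p => by
  rw [div_one, expectedRevenue_self]

theorem mul_le_OPT {v : Fin n → ℝ≥0} {k : ℕ} {t : ℝ≥0} (h : k ≤ count v t) : k * t ≤ OPT v :=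
  calc (k : ℝ≥0) * t ≤ count v t * t := by gcongr
    _ = ∑ j with t ≤ v j, t := by simp [count]
    _ ≤ ∑ j with t ≤ v j, v j := Finset.sum_le_sum fun j hj => by simpa using hj
    _ ≤ OPT v := Finset.sum_le_sum_of_subset (Finset.filter_subset _ _)

theorem expectedRevenue_nonneg (A : RandomAuction n) (b : Fin n → ℝ≥0) : 0 ≤ A.expectedRevenue b :=
  integral_nonneg fun _ => Finset.sum_nonneg fun _ _ => NNReal.coe_nonneg _

/-- The choice of `q` lies just above `2 / 4.42`, as forced by the case `k = 2` both for Vickrey and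
for a lone top deviator. -/
theorem mechanism_robust_F2 : (mechanism (181 / 400) : Mechanism n).Robust 4.42 F2 := by
  intro p v
  rw [div_le_iff₀ (by norm_num)]
  rcases F2_eq v with h0 | ⟨k, t, hk2, hk, he⟩
  · rw [h0]
    have := expectedRevenue_nonneg (mechanism (181 / 400) p) v
    push_cast
    positivity
  have he' : (F2 v : ℝ) = k * t := by rw [he]; push_cast; rfl
  have ht0 : (0 : ℝ) ≤ t := t.2
  have hk2' : (2 : ℝ) ≤ k := by exact_mod_cast hk2
  have hkc : ((k - 1 : ℕ) : ℝ) = k - 1 := by rw [Nat.cast_sub (by omega), Nat.cast_one]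
  rw [he']
  by_cases hpv : v = p
  · rw [← hpv, expectedRevenue_self]
    have : (k : ℝ) * t ≤ OPT v := by exact_mod_cast mul_le_OPT hk
    nlinarith
  rcases expectedRevenue_bound (q := 181 / 400) (by norm_num) (by norm_num) hpv hk2 hk with
    ⟨a, ha⟩ | ⟨hV, hshare⟩
  · have h := count_sub_one_mul_le_sum (v := v) (t := t) (k := k - 1) (by omega) a
    have h' : ((k : ℝ) - 1) * t ≤ ∑ j ∈ Finset.univ.erase a, (v j : ℝ) := by
      rw [← hkc]
      exact_mod_cast h
    nlinarith
  rcases hk2.eq_or_lt with rfl | hk3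
  · push_cast at *
    nlinarith
  have hk3' : (3 : ℝ) ≤ k := by exact_mod_cast hk3
  rcases ht0.eq_or_lt with ht | ht
  · rw [← ht]
    have := expectedRevenue_nonneg (mechanism (181 / 400) p) v
    rw [mul_zero]
    positivity
  -- Without `i` at least `k - 1 ≥ 2` bidders remain above `t`.
  have hE : ∀ i, ((k : ℝ) - 1) * t ≤ F2 (Function.update v i 0) ∧
      (F2 (Function.update v i 0) : ℝ) ≤ k * t := by
    intro i
    constructor
    · have h := le_F2 (v := Function.update v i 0) (t := t) (k := k - 1) (by omega)
        (by have := count_le_count_update v i t; omega)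
      rw [← hkc]
      exact_mod_cast h
    · rw [← he']
      exact_mod_cast F2_mono (update_le_self_iff.2 zero_le)
  -- In `x = 1 / k` both revenue bounds become `k * t` times a quadratic; the squares supplied below
  -- are centred near the minimisers.
  obtain ⟨x, hx, hx0, hx3⟩ : ∃ x : ℝ, (k : ℝ) * x = 1 ∧ 0 < x ∧ x ≤ 1 / 3 :=
    ⟨1 / k, by field_simp, by positivity, one_div_le_one_div_of_le (by norm_num) hk3'⟩
  have hxk : x = 1 / k := by field_simp; linarith
  have htx : (t : ℝ) = k * t * x := by linear_combination -(t : ℝ) * hx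
  have hkt : 0 < (k : ℝ) * t := by positivity
  have h2k : (2 : ℝ) / k = 2 * x := by rw [hxk]; ring
  rcases hshare ((k - 1) * t) (k * t) hk3 (by nlinarith) hE (by nlinarith) (by nlinarith)
    (by nlinarith) with h | h
  · rw [← hxk] at h
    have e : 181 / 400 * (t : ℝ) + (1 - 181 / 400) / (8 / 5) *
        ((1 - x) * ((k - 1) * t - 0.202 * (k * t))) = k * t * (181 / 400 * x +
          (1 - 181 / 400) / (8 / 5) * ((1 - x) * (0.798 - x))) := by
      linear_combination (181 / 400 - (1 - 181 / 400) / (8 / 5) * (1 - x)) * htx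
    have : (1 / 4.42 : ℝ) ≤ 181 / 400 * x + (1 - 181 / 400) / (8 / 5) * ((1 - x) * (0.798 - x)) := by
      nlinarith [sq_nonneg (x - 0.238)]
    rw [e] at h
    nlinarith [mul_le_mul_of_nonneg_left this hkt.le]
  · rw [h2k] at h
    have e : 181 / 400 * (t : ℝ) + 2 * ((1 - 2 * (181 / 400)) * t) + (1 - 181 / 400) / (8 / 5) *
        ((1 - 2 * x) * ((k - 1) * t - 0.202 * (k * t))) = k * t * (257 / 400 * x +
          (1 - 181 / 400) / (8 / 5) * ((1 - 2 * x) * (0.798 - x))) := by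
      linear_combination (257 / 400 - (1 - 181 / 400) / (8 / 5) * (1 - 2 * x)) * htx
    have : (1 / 4.42 : ℝ) ≤ 257 / 400 * x +
        (1 - 181 / 400) / (8 / 5) * ((1 - 2 * x) * (0.798 - x)) := by
      nlinarith [sq_nonneg (x - 0.18)]
    rw [e] at h
    nlinarith [mul_le_mul_of_nonneg_left this hkt.le]

theorem mechanism_robust_maxV :
    (mechanism (27 / 100) : Mechanism n).Robust (Real.exp 1 + 1) maxV := by
  intro p v
  have hexp := Real.exp_one_gt_d9
  have hrev := expectedRevenue_nonneg (mechanism (27 / 100) p) v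
  rw [div_le_iff₀ (by linarith)]
  -- `0.269` exceeds `1 / (e + 1)` slightly, so `q = 0.27` suffices when only Vickrey or charging is
  -- used.
  suffices h : 0.269 * (maxV v : ℝ) ≤ (mechanism (27 / 100) p).expectedRevenue v by
    nlinarith
  rcases maxV_eq v with h0 | ⟨k, t, hk, he⟩
  · rw [h0]; simpa using hrev
  have he' : (maxV v : ℝ) = k * t := by rw [he]; push_cast; rfl
  have ht0 : (0 : ℝ) ≤ t := t.2
  rw [he']
  rcases Nat.eq_zero_or_pos k with rfl | hk1
  · simpa using hrev
  rcases ht0.eq_or_lt with ht | ht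
  · rw [← ht]; simpa using hrev
  have hk1' : (1 : ℝ) ≤ k := by exact_mod_cast hk1
  have hkt : 0 < (k : ℝ) * t := by positivity
  by_cases hpv : v = p
  · rw [← hpv, expectedRevenue_self]
    have : (k : ℝ) * t ≤ OPT v := by exact_mod_cast mul_le_OPT (by omega : k ≤ count v t)
    linarith
  rcases expectedRevenue_bound (q := 27 / 100) (by norm_num) (by norm_num) hpv
    (by omega : 2 ≤ k + 1) hk with ⟨a, ha⟩ | ⟨hV, hshare⟩
  · have h : (k : ℝ) * t ≤ ∑ j ∈ Finset.univ.erase a, (v j : ℝ) := by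
      exact_mod_cast count_sub_one_mul_le_sum hk a
    linarith
  rcases Nat.eq_or_lt_of_le hk1 with rfl | hk2
  · push_cast
    linarith
  have hE : ∀ i, (k : ℝ) * t ≤ F2 (Function.update v i 0) ∧
      (F2 (Function.update v i 0) : ℝ) ≤ 2 * (k * t) := by
    intro i
    constructor
    · exact_mod_cast le_F2 (v := Function.update v i 0) (t := t) (k := k) (by omega)
        (by have := count_le_count_update v i t; omega)
    · rw [← he']
      exact_mod_cast (F2_mono (update_le_self_iff.2 zero_le)).trans (F2_le_two_mul_maxV v)
  have hk2' : (2 : ℝ) ≤ k := by exact_mod_cast hk2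
  -- `c` counts the lost shares and `0.596 = 1 - 2 * 0.202`. There are `k + 1` bidders above `t`;
  -- weakening to `k` makes the loss a fixed multiple of `t`.
  have key : ∀ c : ℝ, 0 ≤ c → c ≤ 2 → (1 - c / k) * (0.596 * (k * t)) ≤
      (1 - c / (k + 1 : ℕ)) * (k * t - 0.202 * (2 * (k * t))) := by
    intro c hc hc2
    have : (1 - c / k) ≤ (1 - c / (k + 1 : ℕ)) := by
      push_cast
      gcongr
      linarith
    calc _ ≤ (1 - c / (k + 1 : ℕ)) * (0.596 * (k * t)) := by gcongr
      _ = _ := by ring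
  have e1 : (1 - (1 : ℝ) / k) * (0.596 * (k * t)) = 0.596 * (k * t) - 0.596 * t := by field_simp
  have e2 : (1 - (2 : ℝ) / k) * (0.596 * (k * t)) = 0.596 * (k * t) - 1.192 * t := by
    field_simp; ring
  have k1 := key 1 (by norm_num) (by norm_num)
  have k2 := key 2 (by norm_num) (by norm_num)
  rw [e1] at k1
  rw [e2] at k2
  rcases hshare (k * t) (2 * (k * t)) (by omega) hkt hE (by linarith) le_rfl
    (by push_cast; nlinarith) with h | h
  · nlinarith
  · nlinarith

end DigitalGood

end

theorem mainTheorem7 (n : ℕ) :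
    (∃ M : DigitalGood.Mechanism n,
      M.Truthful ∧ M.Consistent 1 DigitalGood.OPT ∧ M.Robust 4.42 DigitalGood.F2) ∧
    (∃ M : DigitalGood.Mechanism n,
      M.Truthful ∧ M.Consistent 1 DigitalGood.OPT ∧
        M.Robust (Real.exp 1 + 1) DigitalGood.maxV) :=
  ⟨⟨_, DigitalGood.mechanism_truthful _, DigitalGood.mechanism_consistent _,
      DigitalGood.mechanism_robust_F2⟩,
    ⟨_, DigitalGood.mechanism_truthful _, DigitalGood.mechanism_consistent _,
      DigitalGood.mechanism_robust_maxV⟩⟩
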